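/- Let $\mathbb{K}$ be $\mathbb{R}$ or $\mathbb{C}$ and let $F$ be a Banach space over $\mathbb{K}$. Recall that $F$ has the Schur property if every weakly convergent sequence in $F$ is norm convergent. If $F$ fails to have the Schur property, then there exists a reflexive Banach space $E$ over $\mathbb{K}$ with a Schauder basis such that $\mathcal{K}(E,F) \neq \mathcal{L}(E,F)$, where $\mathcal{L}(E,F)$ denotes the space of all bounded linear operators from $E$ into $F$ and $\mathcal{K}(E,F)$ the subspace of compact operators. -/

import Mathlib

open Filter Topology

universe u v

/-- A normed space has the Schur property if every weakly convergent sequence converges in norm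
(necessarily to its weak limit). -/
def HasSchurProperty (𝕜 : Type*) [RCLike 𝕜] (F : Type*) [NormedAddCommGroup F]
    [NormedSpace 𝕜 F] : Prop :=
  ∀ (x : ℕ → F) (a : F),
    Tendsto (fun n => toWeakSpace 𝕜 F (x n)) atTop (𝓝 (toWeakSpace 𝕜 F a)) →
      Tendsto x atTop (𝓝 a)

/-- A normed space is reflexive if the canonical embedding into its bidual is onto. -/
def IsReflexiveSpace (𝕜 : Type*) [RCLike 𝕜] (E : Type*) [NormedAddCommGroup E]
    [NormedSpace 𝕜 E] : Prop :=
  Function.Surjective (NormedSpace.inclusionInDoubleDual 𝕜 E)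

/-! ### Basic sequences and Bessaga–Pełczyński selection. -/

section BasicSequence

variable {𝕜 : Type v} [RCLike 𝕜] {F : Type u} [NormedAddCommGroup F] [NormedSpace 𝕜 F]

/-! Without the Schur property there is a weakly null sequence in `F` bounded away from zero, and a
subsequence of it is a Schauder basis `b` of a closed subspace `X` (`exists_basic_subseq`,
`exists_schauderBasis_of_basic`). If a bounded sequence in a reflexive `E` is mapped onto `b`, the
map cannot be compact: a norm limit of a subsequence of images would be both zero and of norm at
least `δ`.

Such an `E` comes from Davis–Figiel–Johnson–Pełczyński interpolation. Let `U` be the unit ball of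
`X` and `W` the vectors whose coordinates have `ℓ¹`-norm at most one. The gauges of `2^j W + 2^{-j}
U` are equivalent norms on `X`, and `E` is the diagonal of the `ℓ²`-sum of these renormings. Each `b
n` lies in `W`, so its `j`-th gauge is at most `2^{-j}` and it lifts to a bounded vector of `E`. The
lifts form a basis, since the basis projections are bounded uniformly in all gauges.

Reflexivity is James's criterion (`isReflexiveSpace_of_basis`). The basis of `E` is shrinking
because a functional on `X` is uniformly small on tails of elements of `W`, by weak nullity; it is
boundedly complete because coordinates of elements of `W` have pointwise convergent subsequences
with limits in the `ℓ¹`-ball. The error from `U` vanishes as `j` grows. -/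

/-- A finite-dimensional subspace is normed, up to the factor `2`, by finitely many functionals. -/
theorem exists_finite_norming (V : Submodule 𝕜 F) [FiniteDimensional 𝕜 V] :
    ∃ Φ : Set (StrongDual 𝕜 F), Φ.Finite ∧ (∀ f ∈ Φ, ‖f‖ ≤ 1) ∧
      ∀ v ∈ V, ∃ f ∈ Φ, ‖v‖ ≤ 2 * ‖f v‖ := by
  have : ProperSpace V := FiniteDimensional.proper 𝕜 V
  have hcomp : IsCompact (Metric.sphere (0 : V) 1) := isCompact_sphere 0 1
  let U : {f : StrongDual 𝕜 F // ‖f‖ ≤ 1} → Set V := fun f => {v | 1 / 2 < ‖f.1 v‖}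
  obtain ⟨t, ht⟩ := hcomp.elim_finite_subcover U
    (fun f => isOpen_lt continuous_const (by fun_prop)) (by
      intro v hv
      obtain ⟨g, hg, hgv⟩ := exists_dual_vector'' 𝕜 (v : F)
      refine Set.mem_iUnion.2 ⟨⟨g, hg⟩, ?_⟩
      have h1 : ‖(v : F)‖ = 1 := by simpa using hv
      simp only [U, Set.mem_ofPred_eq, hgv, h1]
      norm_num)
  -- The subcover may be empty when `V` is trivial; `0` serves the zero vector.
  refine ⟨insert 0 (Subtype.val '' (t : Set {f : StrongDual 𝕜 F // ‖f‖ ≤ 1})),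
    (t.finite_toSet.image _).insert _, ?_, ?_⟩
  · rintro f (rfl | ⟨f, -, rfl⟩)
    · simp
    · exact f.2
  · intro v hv
    rcases eq_or_ne v 0 with rfl | hv0
    · exact ⟨0, Set.mem_insert _ _, by simp⟩
    have hpos : 0 < ‖v‖ := norm_pos_iff.2 hv0
    have hmem : ((‖v‖ : 𝕜)⁻¹ • (⟨v, hv⟩ : V)) ∈ Metric.sphere (0 : V) 1 := by
      simp [norm_smul, hpos.ne']
    obtain ⟨f, hft, hf⟩ := Set.mem_iUnion₂.1 (ht hmem)
    refine ⟨f.1, Set.mem_insert_of_mem _ ⟨f, hft, rfl⟩, ?_⟩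
    have hf' : 1 / 2 < ‖v‖⁻¹ * ‖f.1 v‖ := by simpa [U] using hf
    rw [inv_mul_eq_div, lt_div_iff₀ hpos] at hf'
    linarith

/-- A weakly null sequence has a subsequence whose tails are almost annihilated by functionals
norming the spans of its initial segments. -/
theorem exists_subseq_norming {y : ℕ → F}
    (hy : ∀ f : StrongDual 𝕜 F, Tendsto (fun n => f (y n)) atTop (𝓝 0)) {η : ℕ → ℝ}
    (hη : ∀ n, 0 < η n) :
    ∃ φ : ℕ → ℕ, StrictMono φ ∧ ∀ (k : ℕ),
      ∀ v ∈ Submodule.span 𝕜 ((fun i => y (φ i)) '' (Finset.range k : Set ℕ)),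
        ∃ f : StrongDual 𝕜 F, ‖f‖ ≤ 1 ∧ ‖v‖ ≤ 2 * ‖f v‖ ∧ ∀ i, k ≤ i → ‖f (y (φ i))‖ ≤ η i := by
  have hfin (n : ℕ) : FiniteDimensional 𝕜 (Submodule.span 𝕜 (y '' (Finset.range n : Set ℕ))) :=
    FiniteDimensional.span_of_finite 𝕜 ((Finset.range n).finite_toSet.image _)
  choose Φ hΦfin hΦ1 hΦ using fun n =>
    exists_finite_norming (Submodule.span 𝕜 (y '' (Finset.range n : Set ℕ)))
  -- All `l ≤ n + 1` are required, since a new term must also be small on the functionals attached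
  -- to earlier, shorter spans.
  have hstep (k n : ℕ) : ∃ m, n < m ∧ ∀ l ≤ n + 1, ∀ f ∈ Φ l, ‖f (y m)‖ ≤ η k := by
    have h1 : ∀ᶠ m in atTop, ∀ l ∈ Set.Iic (n + 1), ∀ f ∈ Φ l, ‖f (y m)‖ ≤ η k := by
      refine (Filter.eventually_all_finite (Set.finite_Iic (n + 1))).2 fun l _ =>
        (Filter.eventually_all_finite (hΦfin l)).2 fun f _ => ?_
      have := (hy f).norm
      rw [norm_zero] at this
      exact (this.eventually_lt_const (hη k)).mono fun _ h => h.le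
    obtain ⟨m, hm1, hm2⟩ := (h1.and (eventually_gt_atTop n)).exists
    exact ⟨m, hm2, hm1⟩
  choose g hgt hg using hstep
  let φ : ℕ → ℕ := fun k => Nat.rec 0 (fun k n => g (k + 1) n) k
  have hφs (k : ℕ) : φ (k + 1) = g (k + 1) (φ k) := rfl
  have hφ : StrictMono φ := strictMono_nat_of_lt_succ fun k => by rw [hφs]; exact hgt _ _
  refine ⟨φ, hφ, fun k v hv => ?_⟩
  rcases k with _ | k
  · have : v = 0 := by simpa using hv
    exact ⟨0, by simp, by simp [this], fun i _ => by simpa using (hη i).le⟩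
  have hv' : v ∈ Submodule.span 𝕜 (y '' (Finset.range (φ k + 1) : Set ℕ)) := by
    refine Submodule.span_mono ?_ hv
    rintro _ ⟨i, hi, rfl⟩
    refine ⟨φ i, ?_, rfl⟩
    have hik : i ≤ k := by simpa [Nat.lt_succ_iff] using hi
    simpa [Nat.lt_succ_iff] using hφ.monotone hik
  obtain ⟨f, hf, hfv⟩ := hΦ _ v hv'
  refine ⟨f, hΦ1 _ f hf, hfv, fun i hi => ?_⟩
  obtain ⟨j, rfl⟩ : ∃ j, i = j + 1 := ⟨i - 1, by omega⟩
  rw [hφs]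
  exact hg _ _ (φ k + 1) (Nat.succ_le_succ (hφ.monotone (by omega))) f hf

/-- A sequence bounded below with almost annihilating norming functionals is a basic sequence. -/
theorem norm_sum_range_le_of_norming {z : ℕ → F} {δ : ℝ} (hδ : 0 < δ) (hz : ∀ n, δ ≤ ‖z n‖)
    {η : ℕ → ℝ} (hη : ∀ n, ∑ i ∈ Finset.range n, η i ≤ δ / 8) (hη0 : ∀ n, 0 ≤ η n)
    (hnorm : ∀ (k : ℕ), ∀ v ∈ Submodule.span 𝕜 (z '' (Finset.range k : Set ℕ)),
        ∃ f : StrongDual 𝕜 F, ‖f‖ ≤ 1 ∧ ‖v‖ ≤ 2 * ‖f v‖ ∧ ∀ i, k ≤ i → ‖f (z i)‖ ≤ η i)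
    (a : ℕ → 𝕜) {m n : ℕ} (hmn : m ≤ n) :
    ‖∑ i ∈ Finset.range m, a i • z i‖ ≤ 4 * ‖∑ i ∈ Finset.range n, a i • z i‖ := by
  let s : ℕ → F := fun m => ∑ i ∈ Finset.range m, a i • z i
  -- It suffices to bound the largest partial sum `s M`. Maximality bounds every coefficient by `2‖s
  -- M‖/δ`, so the tail costs `f` at most `‖s M‖/4`. Then `‖s M‖ ≤ 2(‖s n‖ + ‖s M‖/4)`, whence the
  -- factor `4`.
  obtain ⟨M, hM, hmax⟩ := Finset.exists_max_image (Finset.range (n + 1)) (fun m => ‖s m‖)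
    ⟨0, by simp⟩
  have hMn : M ≤ n := by simpa [Nat.lt_succ_iff] using hM
  replace hmax : ∀ m ≤ n, ‖s m‖ ≤ ‖s M‖ := fun m hm =>
    hmax m (by simpa [Nat.lt_succ_iff] using hm)
  change ‖s m‖ ≤ 4 * ‖s n‖
  refine (hmax m hmn).trans ?_
  have hcoef (i : ℕ) (hi : i < n) : ‖a i‖ * δ ≤ 2 * ‖s M‖ := by
    have h1 : a i • z i = s (i + 1) - s i := by simp [s, Finset.sum_range_succ]
    calc ‖a i‖ * δ ≤ ‖a i‖ * ‖z i‖ := by gcongr; exact hz i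
      _ = ‖s (i + 1) - s i‖ := by rw [← norm_smul, h1]
      _ ≤ ‖s (i + 1)‖ + ‖s i‖ := norm_sub_le _ _
      _ ≤ ‖s M‖ + ‖s M‖ := add_le_add (hmax _ hi) (hmax _ hi.le)
      _ = 2 * ‖s M‖ := by ring
  obtain ⟨f, hf1, hfM, hft⟩ := hnorm M (s M) (Submodule.sum_mem _ fun i hi =>
    Submodule.smul_mem _ _ (Submodule.subset_span ⟨i, hi, rfl⟩))
  have hsplit : s n = s M + ∑ i ∈ Finset.Ico M n, a i • z i :=
    (Finset.sum_range_add_sum_Ico _ hMn).symm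
  have htail : ‖f (∑ i ∈ Finset.Ico M n, a i • z i)‖ ≤ ‖s M‖ / 4 := by
    calc ‖f (∑ i ∈ Finset.Ico M n, a i • z i)‖ = ‖∑ i ∈ Finset.Ico M n, a i * f (z i)‖ := by
          simp
      _ ≤ ∑ i ∈ Finset.Ico M n, 2 * ‖s M‖ / δ * η i := by
          refine norm_sum_le_of_le _ fun i hi => ?_
          rw [Finset.mem_Ico] at hi
          rw [norm_mul]
          refine mul_le_mul ?_ (hft i hi.1) (norm_nonneg _) (by positivity)
          rw [le_div_iff₀ hδ]
          exact hcoef i hi.2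
      _ ≤ ∑ i ∈ Finset.range n, 2 * ‖s M‖ / δ * η i := by
          refine Finset.sum_le_sum_of_subset_of_nonneg ?_ fun i _ _ =>
            mul_nonneg (by positivity) (hη0 i)
          intro i hi
          simp only [Finset.mem_Ico, Finset.mem_range] at hi ⊢
          exact hi.2
      _ ≤ 2 * ‖s M‖ / δ * (δ / 8) := by
          rw [← Finset.mul_sum]
          gcongr
          exact hη n
      _ = ‖s M‖ / 4 := by field_simp; ring
  have hfs : f (s M) = f (s n) - f (∑ i ∈ Finset.Ico M n, a i • z i) := by
    rw [hsplit, map_add]; abel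
  have hfn : ‖f (s n)‖ ≤ ‖s n‖ := by
    simpa using f.le_of_opNorm_le hf1 (s n)
  have := norm_sub_le (f (s n)) (f (∑ i ∈ Finset.Ico M n, a i • z i))
  rw [← hfs] at this
  linarith

/-- **Bessaga–Pełczyński selection**: a weakly null sequence bounded away from zero has a basic
subsequence. -/
theorem exists_basic_subseq {y : ℕ → F}
    (hy : ∀ f : StrongDual 𝕜 F, Tendsto (fun n => f (y n)) atTop (𝓝 0)) {δ : ℝ} (hδ : 0 < δ)
    (hyδ : ∀ n, δ ≤ ‖y n‖) :
    ∃ φ : ℕ → ℕ, StrictMono φ ∧ ∀ (a : ℕ → 𝕜) (m n : ℕ), m ≤ n →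
      ‖∑ i ∈ Finset.range m, a i • y (φ i)‖ ≤ 4 * ‖∑ i ∈ Finset.range n, a i • y (φ i)‖ := by
  obtain ⟨φ, hφ, h⟩ := exists_subseq_norming hy (η := fun n => δ / 16 * (1 / 2) ^ n)
    (fun n => by positivity)
  refine ⟨φ, hφ, fun a m n hmn => norm_sum_range_le_of_norming (z := fun i => y (φ i)) hδ
    (fun n => hyδ _) (fun n => ?_) (fun n => by positivity) h a hmn⟩
  have h2 := sum_geometric_two_le n
  rw [← Finset.mul_sum]
  nlinarith

/-- A linear functional on the closed span of a basic sequence reading off a coordinate. -/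
theorem exists_dual_of_basic {z : ℕ → F} {δ K : ℝ} (hδ : 0 < δ) (hz : ∀ n, δ ≤ ‖z n‖)
    (hK : ∀ (a : ℕ → 𝕜) (m n : ℕ), m ≤ n →
      ‖∑ i ∈ Finset.range m, a i • z i‖ ≤ K * ‖∑ i ∈ Finset.range n, a i • z i‖) (k : ℕ) :
    ∃ g : StrongDual 𝕜 F, ∀ i, g (z i) = if i = k then 1 else 0 := by
  -- A term is a difference of two consecutive partial sums. This bound yields both linear
  -- independence and continuity of the coordinates.
  have hbound (l : ℕ →₀ 𝕜) (k : ℕ) :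
      ‖l k‖ ≤ 2 * K / δ * ‖Finsupp.linearCombination 𝕜 z l‖ := by
    obtain ⟨n, hn⟩ : ∃ n, l.support ⊆ Finset.range n := l.support.exists_nat_subset_range
    let N := max n (k + 1)
    have hl : Finsupp.linearCombination 𝕜 z l = ∑ i ∈ Finset.range N, l i • z i := by
      rw [Finsupp.linearCombination_apply, Finsupp.sum_of_support_subset l
        (hn.trans (Finset.range_mono (le_max_left _ _))) _ (by simp)]
    have h1 : l k • z k = ∑ i ∈ Finset.range (k + 1), l i • z i
        - ∑ i ∈ Finset.range k, l i • z i := by simp [Finset.sum_range_succ]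
    have h2 : ‖l k‖ * δ ≤ 2 * K * ‖Finsupp.linearCombination 𝕜 z l‖ := by
      calc ‖l k‖ * δ ≤ ‖l k‖ * ‖z k‖ := by gcongr; exact hz k
        _ = ‖l k • z k‖ := (norm_smul _ _).symm
        _ ≤ _ := by rw [h1]; exact norm_sub_le _ _
        _ ≤ K * ‖∑ i ∈ Finset.range N, l i • z i‖ + K * ‖∑ i ∈ Finset.range N, l i • z i‖ :=
          add_le_add (hK _ _ _ (le_max_right _ _))
            (hK _ _ _ ((Nat.le_succ k).trans (le_max_right _ _)))
        _ = 2 * K * ‖Finsupp.linearCombination 𝕜 z l‖ := by rw [hl]; ring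
    rw [div_mul_eq_mul_div, le_div_iff₀ hδ]
    exact h2
  have hli : LinearIndependent 𝕜 z := by
    rw [linearIndependent_iff]
    intro l hl
    ext k
    have := hbound l k
    rw [hl, norm_zero, mul_zero] at this
    simpa using this
  let V := Submodule.span 𝕜 (Set.range z)
  let f₀ : V →ₗ[𝕜] 𝕜 := (Finsupp.lapply k).comp hli.repr
  let f : StrongDual 𝕜 V := f₀.mkContinuous (2 * K / δ) fun x => by
    have := hbound (hli.repr x) k
    rwa [hli.linearCombination_repr] at this
  obtain ⟨g, hg, -⟩ := exists_extension_norm_eq V f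
  refine ⟨g, fun i => ?_⟩
  have hzi : z i ∈ V := Submodule.subset_span ⟨i, rfl⟩
  have h1 := hg ⟨z i, hzi⟩
  rw [h1]
  change (hli.repr ⟨z i, hzi⟩) k = _
  rw [hli.repr_eq_single i _ rfl, Finsupp.single_apply]

/-- A basic sequence is a Schauder basis of a closed subspace. -/
theorem exists_schauderBasis_of_basic [CompleteSpace F] {z : ℕ → F} {δ K : ℝ} (hδ : 0 < δ)
    (hz : ∀ n, δ ≤ ‖z n‖) (hK : ∀ (a : ℕ → 𝕜) (m n : ℕ), m ≤ n →
      ‖∑ i ∈ Finset.range m, a i • z i‖ ≤ K * ‖∑ i ∈ Finset.range n, a i • z i‖) :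
    ∃ (X : Submodule 𝕜 F) (_ : CompleteSpace X) (b : SchauderBasis 𝕜 X), ∀ n, (b n : F) = z n := by
  choose g hg using exists_dual_of_basic hδ hz hK
  let X := (Submodule.span 𝕜 (Set.range z)).topologicalClosure
  let e : ℕ → X := fun n =>
    ⟨z n, Submodule.le_topologicalClosure _ (Submodule.subset_span ⟨n, rfl⟩)⟩
  let P : ℕ → F →L[𝕜] F := fun n => ∑ i ∈ Finset.range n, (g i).smulRight (z i)
  have hPapp (n : ℕ) (x : F) : P n x = ∑ i ∈ Finset.range n, g i x • z i := by
    simp [P]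
  -- The `P n` eventually fix each vector of the span and are bounded by `K` on its closure, hence
  -- converge pointwise there.
  have hspan : ∀ x ∈ Submodule.span 𝕜 (Set.range z), ∃ N, ∀ n, N ≤ n → P n x = x := by
    intro x hx
    induction hx using Submodule.span_induction with
    | mem x hx =>
      obtain ⟨k, rfl⟩ := hx
      refine ⟨k + 1, fun n hn => ?_⟩
      rw [hPapp]
      simp [hg, Nat.lt_of_succ_le hn]
    | zero => exact ⟨0, by simp⟩
    | add x y _ _ hx hy =>
      obtain ⟨N, hN⟩ := hx
      obtain ⟨M, hM⟩ := hy
      exact ⟨max N M, fun n hn => by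
        rw [map_add, hN n (le_of_max_le_left hn), hM n (le_of_max_le_right hn)]⟩
    | smul c x _ hx =>
      obtain ⟨N, hN⟩ := hx
      exact ⟨N, fun n hn => by rw [map_smul, hN n hn]⟩
  have hbd (n : ℕ) : ∀ x ∈ X, ‖P n x‖ ≤ K * ‖x‖ := by
    intro x hx
    refine closure_minimal (s := (Submodule.span 𝕜 (Set.range z) : Set F))
      (t := {x | ‖P n x‖ ≤ K * ‖x‖}) (fun x hx => ?_)
      (isClosed_le (by fun_prop) (by fun_prop)) hx
    obtain ⟨N, hN⟩ := hspan x hx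
    have := hK (fun i => g i x) n (max n N) (le_max_left _ _)
    rwa [← hPapp, ← hPapp, hN _ (le_max_right _ _)] at this
  have hK0 : 0 ≤ K := by
    have h0 : 0 < ‖z 0‖ := hδ.trans_le (hz 0)
    have := (norm_nonneg _).trans (hbd 0 (z 0) (e 0).2)
    nlinarith
  have hconv : ∀ x ∈ X, Tendsto (fun n => P n x) atTop (𝓝 x) := by
    intro x hx
    rw [Metric.tendsto_atTop]
    intro ε hε
    obtain ⟨w, hw, hxw⟩ := Metric.mem_closure_iff.1 hx (ε / (K + 1)) (by positivity)
    rw [dist_eq_norm] at hxw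
    obtain ⟨N, hN⟩ := hspan w hw
    refine ⟨N, fun n hn => ?_⟩
    have h1 : P n x - x = P n (x - w) - (x - w) := by rw [map_sub, hN n hn]; abel
    have h2 := hbd n (x - w) (X.sub_mem hx (Submodule.le_topologicalClosure _ hw))
    rw [dist_eq_norm, h1]
    have h3 := norm_sub_le (P n (x - w)) (x - w)
    rw [lt_div_iff₀ (by positivity)] at hxw
    linarith
  refine ⟨X, (Submodule.isClosed_topologicalClosure _).completeSpace_coe,
    { basis := e, coord := fun n => (g n).comp X.subtypeL, ortho := fun i j => ?_,
      expansion := fun x => ?_ }, fun n => rfl⟩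
  · simp [e, hg, Pi.single_apply, eq_comm]
  · rw [HasSum, SummationFilter.conditional_filter_eq_map_range, tendsto_map'_iff,
      tendsto_subtype_rng]
    refine (hconv x x.2).congr fun n => ?_
    simp [hPapp, e]

end BasicSequence

/-! ### Functionals on `ℓ²`-sums. -/

section LpTwo

variable {𝕜 : Type v} [RCLike 𝕜] {G : ℕ → Type u} [∀ j, NormedAddCommGroup (G j)]
  [∀ j, NormedSpace 𝕜 (G j)]

theorem lp.hasSum_norm_sq (z : lp G 2) : HasSum (fun j => ‖z j‖ ^ 2) (‖z‖ ^ 2) := by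
  have := lp.hasSum_norm (p := 2) (by simp) z
  simpa using this

theorem memℓp_two_of_summable {z : ∀ j, G j} (h : Summable fun j => ‖z j‖ ^ 2) :
    Memℓp z 2 := memℓp_gen (by simpa using h)

theorem lp.sum_single_apply (z : lp G 2) (J j : ℕ) :
    (∑ i ∈ Finset.range J, lp.single 2 i (z i)) j = if j < J then z j else 0 := by
  rw [lp.coeFn_sum, Finset.sum_apply]
  split_ifs with h
  · rw [Finset.sum_eq_single_of_mem j (by simpa using h)]
    · exact lp.single_apply_self _ _ _
    · intro i _ hij
      exact lp.single_apply_ne _ _ _ hij.symm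
  · refine Finset.sum_eq_zero fun i hi => lp.single_apply_ne _ _ _ ?_
    rintro rfl
    exact h (by simpa using hi)

/-- A functional on an `ℓ²`-sum is approximated in norm by its restrictions to finitely many
summands. -/
theorem lp.exists_norm_sub_sum_single_le (f : StrongDual 𝕜 (lp G 2)) {ε : ℝ} (hε : 0 < ε) :
    ∃ J : ℕ, ∀ z : lp G 2,
      ‖f z - ∑ j ∈ Finset.range J, f (lp.single 2 j (z j))‖ ≤ ε * ‖z‖ := by
  let T : ℕ → lp G 2 → lp G 2 := fun J z => ∑ j ∈ Finset.range J, lp.single 2 j (z j)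
  set A := ‖f‖ with hA
  have hA0 : 0 ≤ A := norm_nonneg f
  -- Adding a disjoint vector of norm `t` to a nearly norming `T J z₁` raises the norm only by
  -- second order, at most `t²/2`. A value of `f` above `t * ε` on it would then exceed `‖f‖`,
  -- because `A * t ≤ ε`.
  let t : ℝ := ε / (A + 1)
  have ht : 0 < t := by positivity
  have htA : t * (A + 1) = ε := by simp only [t]; field_simp
  obtain ⟨z₁, hz₁, hfz₁⟩ := f.exists_lt_apply_of_lt_opNorm (r := A - t * ε / 2)
    (by rw [← hA]; linarith [mul_pos ht hε])
  have hlim : Tendsto (fun J => ‖f (T J z₁)‖) atTop (𝓝 ‖f z₁‖) :=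
    ((f.continuous.tendsto _).comp (lp.hasSum_single (by simp) z₁).tendsto_sum_nat).norm
  obtain ⟨J, hJ⟩ := (hlim.eventually_const_lt hfz₁).exists
  have hTapp : ∀ (z : lp G 2) j, (T J z) j = if j < J then z j else 0 :=
    fun z j => lp.sum_single_apply z J j
  have hTnorm : ‖T J z₁‖ ≤ 1 := by
    refine le_trans ?_ hz₁.le
    refine (sq_le_sq₀ (norm_nonneg _) (norm_nonneg _)).1
      (hasSum_le (fun j => ?_) (lp.hasSum_norm_sq _) (lp.hasSum_norm_sq _))
    rw [hTapp]
    split_ifs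
    · exact le_rfl
    · simp
  have key : ∀ v : lp G 2, (∀ j < J, v j = 0) → ‖v‖ = t → ‖f v‖ ≤ t * ε := by
    intro v hv hvt
    obtain ⟨c, hc, hcf⟩ := RCLike.exists_norm_eq_mul_self (f (T J z₁))
    obtain ⟨d, hd, hdf⟩ := RCLike.exists_norm_eq_mul_self (f v)
    have h1 : f (c • T J z₁ + d • v) = ((‖f (T J z₁)‖ + ‖f v‖ : ℝ) : 𝕜) := by
      rw [map_add, map_smul, map_smul, smul_eq_mul, smul_eq_mul, ← hcf, ← hdf]
      push_cast
      rfl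
    have h2 : HasSum (fun j => ‖(c • T J z₁ + d • v) j‖ ^ 2) (‖T J z₁‖ ^ 2 + ‖v‖ ^ 2) := by
      refine ((lp.hasSum_norm_sq _).add (lp.hasSum_norm_sq _)).congr_fun ?_
      intro j
      rw [lp.coeFn_add, lp.coeFn_smul, lp.coeFn_smul, Pi.add_apply, Pi.smul_apply, Pi.smul_apply]
      by_cases hj : j < J
      · simp [hv j hj, norm_smul, hc]
      · simp [hTapp, hj, norm_smul, hd]
    have h3 : ‖c • T J z₁ + d • v‖ ^ 2 = ‖T J z₁‖ ^ 2 + ‖v‖ ^ 2 :=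
      (lp.hasSum_norm_sq _).unique h2
    have h4 : ‖c • T J z₁ + d • v‖ ≤ 1 + t ^ 2 / 2 := by
      refine (sq_le_sq₀ (norm_nonneg _) (by positivity)).1 ?_
      rw [h3, hvt]
      nlinarith [norm_nonneg (T J z₁), sq_nonneg (t ^ 2)]
    have h5 : ‖f (T J z₁)‖ + ‖f v‖ ≤ A * (1 + t ^ 2 / 2) := by
      calc ‖f (T J z₁)‖ + ‖f v‖ = ‖f (c • T J z₁ + d • v)‖ := by
            rw [h1, RCLike.norm_ofReal, abs_of_nonneg (by positivity)]
        _ ≤ A * ‖c • T J z₁ + d • v‖ := f.le_opNorm _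
        _ ≤ _ := by gcongr
    nlinarith
  refine ⟨J, fun z => ?_⟩
  have hw : f z - ∑ j ∈ Finset.range J, f (lp.single 2 j (z j)) = f (z - T J z) := by
    simp [T]
  rw [hw]
  set w := z - T J z with hwdef
  have hwapp : ∀ j, w j = if j < J then 0 else z j := by
    intro j
    rw [hwdef, lp.coeFn_sub, Pi.sub_apply, hTapp]
    split_ifs <;> simp
  have hwz : ‖w‖ ≤ ‖z‖ := by
    refine (sq_le_sq₀ (norm_nonneg _) (norm_nonneg _)).1
      (hasSum_le (fun j => ?_) (lp.hasSum_norm_sq _) (lp.hasSum_norm_sq _))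
    rw [hwapp]
    split_ifs
    · simp
    · exact le_rfl
  refine le_trans ?_ (mul_le_mul_of_nonneg_left hwz hε.le)
  rcases eq_or_ne w 0 with h0 | h0
  · simp [h0]
  have hpos : 0 < ‖w‖ := norm_pos_iff.2 h0
  have hk := key (((t / ‖w‖ : ℝ) : 𝕜) • w) (fun j hj => by
      rw [lp.coeFn_smul, Pi.smul_apply, hwapp, if_pos hj, smul_zero]) (by
      rw [norm_smul, RCLike.norm_ofReal, abs_of_pos (by positivity)]
      field_simp)
  rw [map_smul, norm_smul, RCLike.norm_ofReal, abs_of_pos (by positivity), div_mul_eq_mul_div,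
    div_le_iff₀ hpos, mul_assoc] at hk
  exact le_of_mul_le_mul_left hk ht

end LpTwo

/-! ### The diagonal of an `ℓ²`-sum of renormings. -/

section Diagonal

variable {𝕜 : Type v} [RCLike 𝕜] {X : Type u} [NormedAddCommGroup X] [NormedSpace 𝕜 X]
  {G : ℕ → Type u} [∀ j, NormedAddCommGroup (G j)] [∀ j, NormedSpace 𝕜 (G j)]

/-- The diagonal of the `ℓ²`-sum of a sequence of renormings of `X`. -/
noncomputable def diagonalSpace (ι : ∀ j, X ≃L[𝕜] G j) : Submodule 𝕜 (lp G 2) :=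
  ⨅ j, LinearMap.ker (lp.evalCLM 𝕜 G 2 j -
    ((ι j : X →L[𝕜] G j) ∘L ((ι 0).symm : G 0 →L[𝕜] X) ∘L lp.evalCLM 𝕜 G 2 0)).toLinearMap

namespace diagonalSpace

variable {ι : ∀ j, X ≃L[𝕜] G j}

theorem mem_iff {z : lp G 2} :
    z ∈ diagonalSpace ι ↔ ∀ j, z j = ι j ((ι 0).symm (z 0)) := by
  rw [diagonalSpace, Submodule.mem_iInf]
  exact forall_congr' fun j => sub_eq_zero

theorem isClosed : IsClosed (diagonalSpace ι : Set (lp G 2)) := by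
  rw [diagonalSpace, Submodule.coe_iInf]
  exact isClosed_iInter fun j => ContinuousLinearMap.isClosed_ker _

instance [∀ j, CompleteSpace (G j)] : CompleteSpace (diagonalSpace ι) :=
  isClosed.completeSpace_coe

variable (ι) in
/-- The inclusion of the diagonal space into `X`. -/
noncomputable def toX : diagonalSpace ι →L[𝕜] X :=
  ((ι 0).symm : G 0 →L[𝕜] X) ∘L lp.evalCLM 𝕜 G 2 0 ∘L (diagonalSpace ι).subtypeL

theorem coe_apply (z : diagonalSpace ι) (j : ℕ) : (z : lp G 2) j = ι j (toX ι z) :=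
  mem_iff.1 z.2 j

theorem hasSum_norm_sq (z : diagonalSpace ι) :
    HasSum (fun j => ‖ι j (toX ι z)‖ ^ 2) (‖z‖ ^ 2) := by
  simp only [← coe_apply]
  exact lp.hasSum_norm_sq (z : lp G 2)

theorem norm_apply_le (z : diagonalSpace ι) (j : ℕ) : ‖ι j (toX ι z)‖ ≤ ‖z‖ := by
  rw [← coe_apply]
  exact lp.norm_apply_le_norm (by simp) _ _

theorem exists_toX_eq {x : X} (h : Summable fun j => ‖ι j x‖ ^ 2) :
    ∃ z : diagonalSpace ι, toX ι z = x := by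
  refine ⟨⟨⟨fun j => ι j x, memℓp_two_of_summable h⟩, mem_iff.2 fun j => ?_⟩, ?_⟩
  · exact congrArg (ι j) ((ι 0).symm_apply_apply x).symm
  · exact (ι 0).symm_apply_apply x

end diagonalSpace

end Diagonal

/-! ### Bases of the diagonal space and James's criterion. -/

section DiagonalBasis

variable {𝕜 : Type v} [RCLike 𝕜] {X : Type u} [NormedAddCommGroup X] [NormedSpace 𝕜 X]
  {G : ℕ → Type u} [∀ j, NormedAddCommGroup (G j)] [∀ j, NormedSpace 𝕜 (G j)]
  {ι : ∀ j, X ≃L[𝕜] G j}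

namespace diagonalSpace

theorem norm_le_of_forall_norm_apply_le {z w : diagonalSpace ι} {C : ℝ} (hC : 0 ≤ C)
    (h : ∀ j, ‖ι j (toX ι z)‖ ≤ C * ‖ι j (toX ι w)‖) : ‖z‖ ≤ C * ‖w‖ := by
  refine (sq_le_sq₀ (norm_nonneg _) (by positivity)).1 ?_
  rw [mul_pow]
  refine hasSum_le (fun j => ?_) (hasSum_norm_sq z) ((hasSum_norm_sq w).mul_left _)
  rw [← mul_pow]
  exact pow_le_pow_left₀ (norm_nonneg _) (h j) 2

/-- A Schauder basis with uniformly bounded projections for all the renormings induces a Schauder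
basis of the diagonal space. -/
theorem exists_basis (b : SchauderBasis 𝕜 X) {C : ℝ}
    (hC : ∀ j m x, ‖ι j (b.proj m x)‖ ≤ C * ‖ι j x‖)
    (hb : ∀ n, Summable fun j => ‖ι j (b n)‖ ^ 2) :
    ∃ e : SchauderBasis 𝕜 (diagonalSpace ι), (∀ n, toX ι (e n) = b n) ∧
      (∀ m z, toX ι (e.proj m z) = b.proj m (toX ι z)) ∧
        ∀ n, e.coord n = (b.coord n).comp (toX ι) := by
  choose e he using fun n => exists_toX_eq (hb n)
  have hsum (m : ℕ) (z : diagonalSpace ι) :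
      toX ι (∑ i ∈ Finset.range m, b.coord i (toX ι z) • e i) = b.proj m (toX ι z) := by
    simp [he]
  refine ⟨{ basis := e, coord := fun n => (b.coord n).comp (toX ι), ortho := fun i j => ?_,
            expansion := fun z => ?_ }, he, fun m z => ?_, fun n => rfl⟩
  · simp [he, b.ortho]
  · rw [HasSum, SummationFilter.conditional_filter_eq_map_range, tendsto_map'_iff,
      tendsto_iff_norm_sub_tendsto_zero]
    have hsq : Tendsto (fun m => ‖∑ i ∈ Finset.range m, b.coord i (toX ι z) • e i - z‖ ^ 2)
        atTop (𝓝 0) := by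
      have h1 (m : ℕ) : ‖∑ i ∈ Finset.range m, b.coord i (toX ι z) • e i - z‖ ^ 2 =
          ∑' j, ‖ι j (b.proj m (toX ι z) - toX ι z)‖ ^ 2 := by
        rw [← (hasSum_norm_sq _).tsum_eq, map_sub, hsum]
      simp only [h1]
      have h2 : (0 : ℝ) = ∑' _ : ℕ, (0 : ℝ) := by simp
      rw [h2]
      -- Each summand tends to zero because every `ι j` is continuous; the uniform `C` supplies the
      -- dominating series.
      refine tendsto_tsum_of_dominated_convergence
        (bound := fun j => (C + 1) ^ 2 * ‖ι j (toX ι z)‖ ^ 2)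
        ((hasSum_norm_sq z).summable.mul_left _) (fun j => ?_) (Eventually.of_forall fun m j => ?_)
      · have h3 : Tendsto (fun m => b.proj m (toX ι z) - toX ι z) atTop (𝓝 0) := by
          simpa using (b.tendsto_proj (toX ι z)).sub_const (toX ι z)
        have h4 := (((ι j).continuous.tendsto 0).comp h3).norm.pow 2
        simpa using h4
      · rw [Real.norm_of_nonneg (by positivity), ← mul_pow, map_sub]
        refine pow_le_pow_left₀ (norm_nonneg _) ?_ 2
        have := norm_sub_le (ι j (b.proj m (toX ι z))) (ι j (toX ι z))
        linarith [hC j m (toX ι z)]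
    have := hsq.sqrt
    simpa using this
  · rw [SchauderBasis.proj_apply]
    exact hsum m z

/-- The basis of the diagonal space is shrinking. -/
theorem exists_norm_sub_comp_proj_le (b : SchauderBasis 𝕜 X) {C : ℝ} (hC0 : 0 ≤ C)
    (hC : ∀ j m x, ‖ι j (b.proj m x)‖ ≤ C * ‖ι j x‖)
    (hshr : ∀ (g : StrongDual 𝕜 X) (ε : ℝ), 0 < ε → ∃ j N, ∀ n, N ≤ n → ∀ x,
      ‖g (x - b.proj n x)‖ ≤ ε * ‖ι j x‖)
    (e : SchauderBasis 𝕜 (diagonalSpace ι)) (he : ∀ m z, toX ι (e.proj m z) = b.proj m (toX ι z))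
    (f : StrongDual 𝕜 (diagonalSpace ι)) {ε : ℝ} (hε : 0 < ε) :
    ∃ N, ∀ n, N ≤ n → ‖f - f.comp (e.proj n)‖ ≤ ε := by
  obtain ⟨F, hF, -⟩ := exists_extension_norm_eq (diagonalSpace ι) f
  -- Up to a small error `f` factors through `toX`. The share `1 + C` pays for that error on `z -
  -- e.proj n z`, and `1` for the tail of `g`.
  have hδ : 0 < ε / (C + 2) := by positivity
  obtain ⟨J, hJ⟩ := lp.exists_norm_sub_sum_single_le F hδ
  let g : StrongDual 𝕜 X := ∑ j ∈ Finset.range J,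
    F ∘L lp.singleContinuousLinearMap 𝕜 G 2 j ∘L (ι j : X →L[𝕜] G j)
  have hg : ∀ z : diagonalSpace ι, ‖f z - g (toX ι z)‖ ≤ ε / (C + 2) * ‖z‖ := by
    intro z
    have := hJ z
    simpa [hF, coe_apply, g] using this
  obtain ⟨j, N, hN⟩ := hshr g _ hδ
  refine ⟨N, fun n hn => ?_⟩
  refine ContinuousLinearMap.opNorm_le_bound _ (by positivity) fun z => ?_
  have h1 := hg (z - e.proj n z)
  have h2 := hN n hn (toX ι z)
  have h3 : ‖z - e.proj n z‖ ≤ (1 + C) * ‖z‖ := by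
    have h4 : ‖e.proj n z‖ ≤ C * ‖z‖ :=
      norm_le_of_forall_norm_apply_le hC0 fun j => by rw [he]; exact hC _ _ _
    linarith [norm_sub_le z (e.proj n z)]
  have h5 : ‖g (toX ι (z - e.proj n z))‖ ≤ ε / (C + 2) * ‖z‖ := by
    rw [map_sub, he]
    exact h2.trans (by gcongr; exact norm_apply_le z j)
  have h6 : (f - f.comp (e.proj n)) z = f (z - e.proj n z) := by
    rw [map_sub]; rfl
  rw [h6]
  have h7 := norm_add_le (f (z - e.proj n z) - g (toX ι (z - e.proj n z)))
    (g (toX ι (z - e.proj n z)))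
  rw [sub_add_cancel] at h7
  calc _ ≤ ε / (C + 2) * ((1 + C) * ‖z‖) + ε / (C + 2) * ‖z‖ :=
        h7.trans (add_le_add (h1.trans (by gcongr)) h5)
    _ = _ := by field_simp; ring

/-- The basis of the diagonal space is boundedly complete. -/
theorem exists_tendsto_of_bounded [CompleteSpace X] (b : SchauderBasis 𝕜 X)
    (hbc : ∀ (a : ℕ → 𝕜) (M : ℝ),
      (∀ j m, ‖ι j (∑ i ∈ Finset.range m, a i • b i)‖ ≤ M) →
        CauchySeq fun m => ∑ i ∈ Finset.range m, a i • b i)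
    (e : SchauderBasis 𝕜 (diagonalSpace ι)) (hen : ∀ n, toX ι (e n) = b n)
    (hcoord : ∀ n, e.coord n = (b.coord n).comp (toX ι))
    (a : ℕ → 𝕜) (M : ℝ) (hM : ∀ m, ‖∑ i ∈ Finset.range m, a i • e i‖ ≤ M) :
    ∃ z, Tendsto (fun m => ∑ i ∈ Finset.range m, a i • e i) atTop (𝓝 z) := by
  have htoX (m : ℕ) : toX ι (∑ i ∈ Finset.range m, a i • e i) =
      ∑ i ∈ Finset.range m, a i • b i := by simp [hen]
  obtain ⟨x, hx⟩ := cauchySeq_tendsto_of_complete (hbc a M fun j m => by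
    rw [← htoX]
    exact (norm_apply_le _ j).trans (hM m))
  -- Fatou-type argument: finite sums over `j` pass to the limit in `m`, so the limit found in `X`
  -- lies in the diagonal space.
  have hsum : Summable fun j => ‖ι j x‖ ^ 2 := by
    refine summable_of_sum_le (c := M ^ 2) (fun j => by positivity) fun s => ?_
    have hlim : Tendsto (fun m => ∑ j ∈ s, ‖ι j (∑ i ∈ Finset.range m, a i • b i)‖ ^ 2) atTop
        (𝓝 (∑ j ∈ s, ‖ι j x‖ ^ 2)) :=
      tendsto_finsetSum _ fun j _ => (((ι j).continuous.tendsto x).comp hx).norm.pow 2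
    refine le_of_tendsto' hlim fun m => ?_
    rw [← htoX]
    exact (sum_le_hasSum s (fun j _ => by positivity) (hasSum_norm_sq _)).trans
      (pow_le_pow_left₀ (norm_nonneg _) (hM m) 2)
  obtain ⟨z, hz⟩ := exists_toX_eq hsum
  refine ⟨z, (e.tendsto_proj z).congr fun m => ?_⟩
  rw [SchauderBasis.proj_apply]
  refine Finset.sum_congr rfl fun n _ => ?_
  congr 1
  rw [hcoord, ContinuousLinearMap.comp_apply, hz]
  refine tendsto_nhds_unique (((b.coord n).continuous.tendsto x).comp hx)
    (tendsto_const_nhds.congr' ?_)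
  filter_upwards [eventually_gt_atTop n] with m hm
  simp [b.ortho, Pi.single_apply, hm]

end diagonalSpace

/-- A Banach space with a shrinking and boundedly complete Schauder basis is reflexive. -/
theorem isReflexiveSpace_of_basis {E : Type u} [NormedAddCommGroup E] [NormedSpace 𝕜 E]
    [CompleteSpace E] (e : SchauderBasis 𝕜 E)
    (hshr : ∀ (f : StrongDual 𝕜 E) (ε : ℝ), 0 < ε →
      ∃ N, ∀ n, N ≤ n → ‖f - f.comp (e.proj n)‖ ≤ ε)
    (hbc : ∀ (a : ℕ → 𝕜) (M : ℝ), (∀ m, ‖∑ i ∈ Finset.range m, a i • e i‖ ≤ M) →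
      ∃ z, Tendsto (fun m => ∑ i ∈ Finset.range m, a i • e i) atTop (𝓝 z)) :
    IsReflexiveSpace 𝕜 E := by
  intro φ
  obtain ⟨C, hC⟩ := e.exists_norm_proj_le
  have hC0 : 0 ≤ C := (norm_nonneg _).trans (hC 0)
  -- A preimage of `φ` must have coordinates `φ (e.coord i)`. Bounded completeness makes the series
  -- converge; shrinking shows that its sum represents `φ`.
  let s : ℕ → E := fun m => ∑ i ∈ Finset.range m, φ (e.coord i) • e i
  have hs (m : ℕ) (f : StrongDual 𝕜 E) : f (s m) = φ (f.comp (e.proj m)) := by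
    have h1 : f.comp (e.proj m) = ∑ i ∈ Finset.range m, f (e i) • e.coord i := by
      ext x
      simp [mul_comm]
    rw [h1]
    simp [s, mul_comm]
  obtain ⟨z, hz⟩ := hbc (fun i => φ (e.coord i)) (‖φ‖ * C) fun m => by
    obtain ⟨f, hf, hfs⟩ := exists_dual_vector'' 𝕜 (s m)
    have h1 : ‖f (s m)‖ = ‖s m‖ := by rw [hfs]; simp
    change ‖s m‖ ≤ _
    rw [← h1, hs]
    refine (φ.le_opNorm _).trans ?_
    gcongr
    calc ‖f.comp (e.proj m)‖ ≤ ‖f‖ * ‖e.proj m‖ := f.opNorm_comp_le _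
      _ ≤ 1 * C := by gcongr; exact hC m
      _ = C := one_mul C
  refine ⟨z, ?_⟩
  ext f
  rw [NormedSpace.dual_def]
  refine tendsto_nhds_unique ((f.continuous.tendsto z).comp hz) ?_
  have hf : Tendsto (fun n => f.comp (e.proj n)) atTop (𝓝 f) := by
    rw [Metric.tendsto_atTop]
    intro ε hε
    obtain ⟨N, hN⟩ := hshr f (ε / 2) (half_pos hε)
    refine ⟨N, fun n hn => ?_⟩
    rw [dist_comm, dist_eq_norm]
    exact (hN n hn).trans_lt (half_lt_self hε)
  exact ((φ.continuous.tendsto f).comp hf).congr fun m => (hs m f).symm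

end DiagonalBasis

/-! ### Interpolation norms attached to a basis. -/

section Renorming

variable {𝕜 : Type v} [RCLike 𝕜] {X : Type u} [NormedAddCommGroup X] [NormedSpace 𝕜 X]

/-- The space `X` carrying a seminorm `p` instead of its norm. -/
def SeminormSpace (_ : Seminorm 𝕜 X) : Type u := X

instance (p : Seminorm 𝕜 X) : AddCommGroup (SeminormSpace p) := inferInstanceAs (AddCommGroup X)

instance (p : Seminorm 𝕜 X) : Module 𝕜 (SeminormSpace p) := inferInstanceAs (Module 𝕜 X)

/-- An equivalent seminorm is realized by an isomorphic Banach space. -/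
theorem exists_renorming [CompleteSpace X] (p : Seminorm 𝕜 X) {c C : ℝ}
    (hc : ∀ x, ‖x‖ ≤ c * p x) (hC : ∀ x, p x ≤ C * ‖x‖) :
    ∃ (G : Type u) (_ : NormedAddCommGroup G) (_ : NormedSpace 𝕜 G) (_ : CompleteSpace G)
      (ι : X ≃L[𝕜] G), ∀ x, ‖ι x‖ = p x := by
  let : Norm (SeminormSpace p) := ⟨p⟩
  have core : NormedSpace.Core 𝕜 (SeminormSpace p) :=
    { norm_nonneg := fun x => apply_nonneg p x
      norm_smul := fun c x => map_smul_eq_mul p c x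
      norm_triangle := fun x y => map_add_le_add p x y
      norm_eq_zero_iff := fun x => by
        refine ⟨fun h => ?_, fun h => ?_⟩
        · have h1 := hc x
          change p x = 0 at h
          rw [h, mul_zero] at h1
          exact norm_le_zero_iff.1 h1
        · rw [h]; exact map_zero p }
  let i1 : NormedAddCommGroup (SeminormSpace p) := NormedAddCommGroup.ofCore core
  let i2 : NormedSpace 𝕜 (SeminormSpace p) := NormedSpace.ofCore core
  let e : X ≃ₗ[𝕜] SeminormSpace p := LinearEquiv.refl 𝕜 X
  let ι : X ≃L[𝕜] SeminormSpace p := e.toContinuousLinearEquivOfBounds C c hC hc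
  exact ⟨SeminormSpace p, i1, i2, (completeSpace_congr (e := ι.toEquiv) ι.isUniformEmbedding).1 ‹_›, ι,
    fun x => rfl⟩

namespace SchauderBasis

variable (b : SchauderBasis 𝕜 X)

theorem norm_le_of_sum_norm_coord_le {B : ℝ} (hB : ∀ n, ‖b n‖ ≤ B) {w : X} {R : ℝ}
    (hw : ∀ m, ∑ i ∈ Finset.range m, ‖b.coord i w‖ ≤ R) : ‖w‖ ≤ B * R := by
  have hB0 : 0 ≤ B := (norm_nonneg _).trans (hB 0)
  refine le_of_tendsto' (b.tendsto_proj w).norm fun m => ?_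
  rw [SchauderBasis.proj_apply]
  calc ‖∑ i ∈ Finset.range m, b.coord i w • b i‖ ≤ ∑ i ∈ Finset.range m, ‖b.coord i w‖ * B :=
        norm_sum_le_of_le _ fun i _ => by rw [norm_smul]; gcongr; exact hB i
    _ ≤ B * R := by
        rw [← Finset.sum_mul, mul_comm]
        gcongr
        exact hw m

theorem coord_proj (m n : ℕ) (x : X) :
    b.coord n (b.proj m x) = if n < m then b.coord n x else 0 := by
  simp [b.ortho, Pi.single_apply]

/-- The radii `r` for which `x` lies in `r (t W + t⁻¹ U)`, where `U` is the closed unit ball and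
`W` consists of the vectors whose coordinates have `ℓ¹`-norm at most one. -/
def radii (t : ℝ) (x : X) : Set ℝ :=
  {r | 0 ≤ r ∧ ∃ w, (∀ m, ∑ i ∈ Finset.range m, ‖b.coord i w‖ ≤ t * r) ∧ ‖x - w‖ ≤ t⁻¹ * r}

variable {b} {t : ℝ}

theorem bddBelow_radii (x : X) : BddBelow (b.radii t x) := ⟨0, fun _ h => h.1⟩

theorem mul_norm_mem_radii (ht : 0 < t) (x : X) : t * ‖x‖ ∈ b.radii t x := by
  refine ⟨by positivity, 0, fun m => ?_, ?_⟩
  · simp only [map_zero, norm_zero, Finset.sum_const_zero]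
    positivity
  · rw [sub_zero, inv_mul_cancel_left₀ ht.ne']

theorem radii_mono (ht : 0 < t) {x : X} {r s : ℝ} (hr : r ∈ b.radii t x) (hrs : r ≤ s) :
    s ∈ b.radii t x := by
  obtain ⟨h0, w, hw, hxw⟩ := hr
  exact ⟨h0.trans hrs, w, fun m => (hw m).trans (by gcongr), hxw.trans (by gcongr)⟩

theorem mem_radii_of_sInf_lt (ht : 0 < t) {x : X} {r : ℝ} (hr : sInf (b.radii t x) < r) :
    r ∈ b.radii t x := by
  obtain ⟨s, hs, hsr⟩ := exists_lt_of_csInf_lt ⟨_, mul_norm_mem_radii ht x⟩ hr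
  exact radii_mono ht hs hsr.le

theorem add_mem_radii {x y : X} {r s : ℝ} (hr : r ∈ b.radii t x) (hs : s ∈ b.radii t y) :
    r + s ∈ b.radii t (x + y) := by
  obtain ⟨h0, w, hw, hxw⟩ := hr
  obtain ⟨h0', w', hw', hxw'⟩ := hs
  refine ⟨add_nonneg h0 h0', w + w', fun m => ?_, ?_⟩
  · calc ∑ i ∈ Finset.range m, ‖b.coord i (w + w')‖
        ≤ ∑ i ∈ Finset.range m, (‖b.coord i w‖ + ‖b.coord i w'‖) :=
          Finset.sum_le_sum fun i _ => by rw [map_add]; exact norm_add_le _ _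
      _ ≤ t * (r + s) := by
          rw [Finset.sum_add_distrib, mul_add]
          exact add_le_add (hw m) (hw' m)
  · rw [add_sub_add_comm, mul_add]
    exact (norm_add_le _ _).trans (add_le_add hxw hxw')

theorem smul_mem_radii {x : X} {r : ℝ} (c : 𝕜) (hr : r ∈ b.radii t x) :
    ‖c‖ * r ∈ b.radii t (c • x) := by
  obtain ⟨h0, w, hw, hxw⟩ := hr
  refine ⟨by positivity, c • w, fun m => ?_, ?_⟩
  · simp only [map_smul, smul_eq_mul, norm_mul]
    rw [← Finset.mul_sum, mul_left_comm]
    gcongr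
    exact hw m
  · rw [← smul_sub, norm_smul, mul_left_comm]
    gcongr

/-- Truncation does not increase the `ℓ¹`-norm of coordinates and dilates `U` by at most `C`; `1 ≤
C` lets one factor serve both. The factor is independent of `t`. -/
theorem proj_mem_radii {C : ℝ} (hC1 : 1 ≤ C) (hC : ∀ m x, ‖b.proj m x‖ ≤ C * ‖x‖) (ht : 0 < t)
    {x : X} {r : ℝ} (m : ℕ) (hr : r ∈ b.radii t x) : C * r ∈ b.radii t (b.proj m x) := by
  obtain ⟨h0, w, hw, hxw⟩ := hr
  refine ⟨by positivity, b.proj m w, fun k => ?_, ?_⟩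
  · calc ∑ i ∈ Finset.range k, ‖b.coord i (b.proj m w)‖
        ≤ ∑ i ∈ Finset.range k, ‖b.coord i w‖ := Finset.sum_le_sum fun i _ => by
          rw [coord_proj]
          split_ifs <;> simp
      _ ≤ t * r := hw k
      _ ≤ t * (C * r) := by
          gcongr
          exact le_mul_of_one_le_left h0 hC1
  · rw [← map_sub, mul_left_comm]
    exact (hC _ _).trans (by gcongr)

theorem le_sInf_radii (ht : 0 < t) {x : X} {s : ℝ} (h : ∀ r ∈ b.radii t x, s ≤ r) :
    s ≤ sInf (b.radii t x) := le_csInf ⟨_, mul_norm_mem_radii ht x⟩ h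

variable (b) in
/-- The gauge of `t W + t⁻¹ U`, where `U` is the unit ball and `W` consists of the vectors whose
coordinates have `ℓ¹`-norm at most one. -/
noncomputable def interpSeminorm (ht : 0 < t) : Seminorm 𝕜 X :=
  Seminorm.ofSMulLE (fun x => sInf (b.radii t x))
    (le_antisymm (by simpa using csInf_le (bddBelow_radii 0) (mul_norm_mem_radii (b := b) ht 0))
      (le_sInf_radii ht fun _ h => h.1))
    (fun x y => by
      refine le_of_forall_pos_lt_add fun ε hε => ?_
      have h1 := add_mem_radii
        (mem_radii_of_sInf_lt ht
          (lt_add_of_pos_right (sInf (b.radii t x)) (show 0 < ε / 3 by positivity)))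
        (mem_radii_of_sInf_lt ht
          (lt_add_of_pos_right (sInf (b.radii t y)) (show 0 < ε / 3 by positivity)))
      linarith [csInf_le (bddBelow_radii _) h1])
    (fun c x => by
      refine le_of_forall_pos_lt_add fun ε hε => ?_
      have h1 := smul_mem_radii c (mem_radii_of_sInf_lt ht
        (lt_add_of_pos_right (sInf (b.radii t x)) (show 0 < ε / (‖c‖ + 1) by positivity)))
      refine (csInf_le (bddBelow_radii _) h1).trans_lt ?_
      rw [mul_add]
      gcongr
      rw [mul_div_left_comm]
      refine mul_lt_of_lt_one_right hε ?_
      rw [div_lt_one (by positivity)]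
      linarith)

theorem interpSeminorm_le (ht : 0 < t) {x : X} {r : ℝ} (h : r ∈ b.radii t x) :
    b.interpSeminorm ht x ≤ r := csInf_le (bddBelow_radii x) h

theorem mem_radii_of_interpSeminorm_lt (ht : 0 < t) {x : X} {r : ℝ}
    (h : b.interpSeminorm ht x < r) : r ∈ b.radii t x := mem_radii_of_sInf_lt ht h

theorem le_mul_interpSeminorm (ht : 0 < t) {x : X} {s c : ℝ} (hc : 0 < c)
    (h : ∀ r ∈ b.radii t x, s ≤ c * r) : s ≤ c * b.interpSeminorm ht x := by
  rw [← div_le_iff₀' hc]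
  exact le_sInf_radii ht fun r hr => (div_le_iff₀' hc).2 (h r hr)

theorem norm_le_interpSeminorm {B : ℝ} (hB : ∀ n, ‖b n‖ ≤ B) (ht : 0 < t) (x : X) :
    ‖x‖ ≤ (B * t + t⁻¹) * b.interpSeminorm ht x := by
  have hB0 : 0 ≤ B := (norm_nonneg _).trans (hB 0)
  refine le_mul_interpSeminorm ht (by positivity) fun r hr => ?_
  obtain ⟨h0, w, hw, hxw⟩ := hr
  have h1 := b.norm_le_of_sum_norm_coord_le hB hw
  have h2 := norm_add_le (x - w) w
  rw [sub_add_cancel] at h2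
  linarith

theorem interpSeminorm_le_norm (ht : 0 < t) (x : X) : b.interpSeminorm ht x ≤ t * ‖x‖ :=
  interpSeminorm_le ht (mul_norm_mem_radii ht x)

/-- Since `b n` lies in `W`, no part from `U` is needed. For `t = 2 ^ j` the bound is square
summable in `j`, uniformly in `n`. -/
theorem interpSeminorm_basis_le (ht : 0 < t) (n : ℕ) : b.interpSeminorm ht (b n) ≤ t⁻¹ := by
  refine interpSeminorm_le ht ⟨by positivity, b n, fun m => ?_, by simp; positivity⟩
  rw [mul_inv_cancel₀ ht.ne']
  calc ∑ i ∈ Finset.range m, ‖b.coord i (b n)‖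
      = ∑ i ∈ Finset.range m, if i = n then (1 : ℝ) else 0 :=
        Finset.sum_congr rfl fun i _ => by
          by_cases h : i = n <;> simp [b.ortho, h]
    _ ≤ 1 := by
        rw [Finset.sum_ite_eq']
        split_ifs <;> norm_num

theorem interpSeminorm_proj_le {C : ℝ} (hC1 : 1 ≤ C) (hC : ∀ m x, ‖b.proj m x‖ ≤ C * ‖x‖)
    (ht : 0 < t) (m : ℕ) (x : X) :
    b.interpSeminorm ht (b.proj m x) ≤ C * b.interpSeminorm ht x :=
  le_mul_interpSeminorm ht (by positivity) fun _ hr =>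
    interpSeminorm_le ht (proj_mem_radii hC1 hC ht m hr)

/-- Pairing `ℓ¹` coordinates with the bounded sequence `g (b k)` gives an estimate uniform over
multiples of `W`; this is how weak nullity becomes shrinking. -/
theorem norm_apply_sub_proj_le (g : StrongDual 𝕜 X) {ε R : ℝ} {w : X}
    (hw : ∀ m, ∑ i ∈ Finset.range m, ‖b.coord i w‖ ≤ R) {n : ℕ} (hε : 0 ≤ ε)
    (hg : ∀ k, n ≤ k → ‖g (b k)‖ ≤ ε) : ‖g (w - b.proj n w)‖ ≤ ε * R := by
  have hlim : Tendsto (fun m => ‖g (b.proj m w - b.proj n w)‖) atTop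
      (𝓝 ‖g (w - b.proj n w)‖) :=
    ((g.continuous.tendsto _).comp ((b.tendsto_proj w).sub_const _)).norm
  refine le_of_tendsto hlim ?_
  filter_upwards [eventually_ge_atTop n] with m hm
  have h1 : b.proj m w - b.proj n w = ∑ i ∈ Finset.Ico n m, b.coord i w • b i := by
    rw [SchauderBasis.proj_apply, SchauderBasis.proj_apply, Finset.sum_Ico_eq_sub _ hm]
  rw [h1, map_sum]
  calc ‖∑ i ∈ Finset.Ico n m, g (b.coord i w • b i)‖
      ≤ ∑ i ∈ Finset.Ico n m, ‖b.coord i w‖ * ε := norm_sum_le_of_le _ fun i hi => by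
        rw [map_smul, norm_smul]
        gcongr
        exact hg i (Finset.mem_Ico.1 hi).1
    _ ≤ ∑ i ∈ Finset.range m, ‖b.coord i w‖ * ε :=
        Finset.sum_le_sum_of_subset_of_nonneg
          (fun i hi => Finset.mem_range.2 (Finset.mem_Ico.1 hi).2) fun i _ _ => by positivity
    _ ≤ ε * R := by
        rw [← Finset.sum_mul, mul_comm]
        gcongr
        exact hw m

/-- For a weakly null basis, functionals are uniformly approximated by their restrictions to
initial segments, relative to a suitable interpolation seminorm. -/
theorem exists_norm_apply_sub_proj_le {C : ℝ} (hC1 : 1 ≤ C) (hC : ∀ m x, ‖b.proj m x‖ ≤ C * ‖x‖)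
    (hb : ∀ g : StrongDual 𝕜 X, Tendsto (fun n => g (b n)) atTop (𝓝 0)) (g : StrongDual 𝕜 X)
    {ε : ℝ} (hε : 0 < ε) :
    ∃ j N : ℕ, ∀ n, N ≤ n → ∀ x, ‖g (x - b.proj n x)‖ ≤
      ε * b.interpSeminorm (t := 2 ^ j) (by positivity) x := by
  -- First `j` makes the `U` part cost at most `ε / 2`; only then is `N` chosen, against the factor
  -- `2 ^ j` on the `W` part.
  obtain ⟨j, hj⟩ : ∃ j : ℕ, (1 + C) * ‖g‖ * (1 / 2) ^ j ≤ ε / 2 := by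
    have h1 : Tendsto (fun j : ℕ => (1 + C) * ‖g‖ * (1 / 2 : ℝ) ^ j) atTop (𝓝 0) := by
      simpa using (tendsto_pow_atTop_nhds_zero_of_lt_one (r := (1 / 2 : ℝ)) (by norm_num)
        (by norm_num)).const_mul ((1 + C) * ‖g‖)
    obtain ⟨j, hj⟩ := (h1.eventually_lt_const (half_pos hε)).exists
    exact ⟨j, hj.le⟩
  have hpow : (0 : ℝ) < 2 ^ j := by positivity
  have hinv : ((2 : ℝ) ^ j)⁻¹ = (1 / 2) ^ j := by simp
  have hbg := (hb g).norm
  rw [norm_zero] at hbg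
  obtain ⟨N, hN⟩ := eventually_atTop.1
    (hbg.eventually_lt_const (show 0 < ε / 2 / 2 ^ j by positivity))
  refine ⟨j, N, fun n hn x => le_mul_interpSeminorm _ hε fun r hr => ?_⟩
  obtain ⟨h0, w, hw, hxw⟩ := hr
  have h1 := norm_apply_sub_proj_le g hw (n := n) (ε := ε / 2 / 2 ^ j) (by positivity)
    fun k hk => (hN k (hn.trans hk)).le
  have h2 : ‖g ((x - w) - b.proj n (x - w))‖ ≤ ε / 2 * r := by
    calc ‖g ((x - w) - b.proj n (x - w))‖ ≤ ‖g‖ * ‖(x - w) - b.proj n (x - w)‖ := g.le_opNorm _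
      _ ≤ ‖g‖ * ((1 + C) * ((1 / 2) ^ j * r)) := by
          gcongr
          rw [hinv] at hxw
          calc _ ≤ ‖x - w‖ + C * ‖x - w‖ := (norm_sub_le _ _).trans (by gcongr; exact hC _ _)
            _ = (1 + C) * ‖x - w‖ := by ring
            _ ≤ _ := by gcongr
      _ = (1 + C) * ‖g‖ * (1 / 2) ^ j * r := by ring
      _ ≤ ε / 2 * r := by gcongr
  have h3 : g (x - b.proj n x) = g (w - b.proj n w) + g ((x - w) - b.proj n (x - w)) := by
    rw [← map_add, map_sub (b.proj n)]
    congr 1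
    abel
  have h4 : ε / 2 / 2 ^ j * (2 ^ j * r) = ε / 2 * r := by field_simp
  rw [h3]
  calc _ ≤ ε / 2 * r + ε / 2 * r := (norm_add_le _ _).trans (add_le_add (h4 ▸ h1) h2)
    _ = ε * r := by ring

/-- Partial sums bounded in one interpolation seminorm are close to an absolutely convergent
series. -/
theorem exists_cauchySeq_near [CompleteSpace X] {B C M : ℝ} (hB : ∀ n, ‖b n‖ ≤ B)
    (hC0 : 0 ≤ C) (hC : ∀ m x, ‖b.proj m x‖ ≤ C * ‖x‖) (ht : 0 < t) {a : ℕ → 𝕜}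
    (ha : ∀ m, b.interpSeminorm ht (∑ i ∈ Finset.range m, a i • b i) < M) :
    ∃ s : ℕ → X, CauchySeq s ∧
      ∀ m, ‖∑ i ∈ Finset.range m, a i • b i - s m‖ ≤ C * (t⁻¹ * M) := by
  choose h0 w hw hxw using fun m => mem_radii_of_interpSeminorm_lt ht (ha m)
  have hcoord (n k : ℕ) : ‖b.coord k (w n)‖ ≤ t * M :=
    (Finset.single_le_sum (f := fun i => ‖b.coord i (w n)‖) (fun i _ => norm_nonneg _)
      (Finset.self_mem_range_succ k)).trans (hw n (k + 1))
  -- Tychonoff yields coordinatewise limits `c` of the `W` parts; finite sums pass to the limit, so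
  -- `c` is in `ℓ¹`.
  obtain ⟨c, -, φ, hφ, hlim⟩ :=
    (isCompact_univ_pi fun _ : ℕ => isCompact_closedBall (0 : 𝕜) (t * M)).tendsto_subseq
      (x := fun n k => b.coord k (w n)) fun n k _ => by simpa using hcoord n k
  rw [tendsto_pi_nhds] at hlim
  have hc (m : ℕ) : ∑ i ∈ Finset.range m, ‖c i‖ ≤ t * M :=
    le_of_tendsto' (tendsto_finsetSum _ fun i _ => (hlim i).norm) fun n => hw _ m
  have hsum : Summable fun i => ‖c i • b i‖ := by
    refine Summable.of_nonneg_of_le (fun i => norm_nonneg _)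
      (fun i => ?_) ((summable_of_sum_range_le (fun i => norm_nonneg (c i)) hc).mul_right B)
    rw [norm_smul]
    gcongr
    exact hB i
  refine ⟨fun m => ∑ i ∈ Finset.range m, c i • b i,
    hsum.of_norm.hasSum.tendsto_sum_nat.cauchySeq, fun m => ?_⟩
  have hlim2 : Tendsto (fun n => ‖∑ i ∈ Finset.range m, a i • b i - b.proj m (w (φ n))‖) atTop
      (𝓝 ‖∑ i ∈ Finset.range m, a i • b i - ∑ i ∈ Finset.range m, c i • b i‖) := by
    simp only [SchauderBasis.proj_apply]
    exact (tendsto_const_nhds.sub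
      (tendsto_finsetSum _ fun i _ => (hlim i).smul_const (b i))).norm
  refine le_of_tendsto hlim2 ?_
  filter_upwards [hφ.tendsto_atTop.eventually_ge_atTop m] with n hn
  -- For `m ≤ φ n` both vectors are images under the same projection, so their distance is
  -- controlled by the `U` part.
  have h1 : ∑ i ∈ Finset.range m, a i • b i = b.proj m (∑ i ∈ Finset.range (φ n), a i • b i) := by
    simp only [map_sum, map_smul, b.proj_apply_basis_mem, smul_ite, smul_zero]
    rw [← Finset.sum_filter]
    congr 1
    ext i
    simp only [Finset.mem_range, Finset.mem_filter]
    omega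
  rw [h1, ← map_sub]
  exact (hC _ _).trans (by gcongr; exact hxw _)

/-- Partial sums uniformly bounded in all the interpolation seminorms form a Cauchy sequence. -/
theorem cauchySeq_of_interpSeminorm_le [CompleteSpace X] {B C M : ℝ} (hB : ∀ n, ‖b n‖ ≤ B)
    (hC0 : 0 ≤ C) (hC : ∀ m x, ‖b.proj m x‖ ≤ C * ‖x‖) {a : ℕ → 𝕜}
    (ha : ∀ j m : ℕ, b.interpSeminorm (t := 2 ^ j) (by positivity)
      (∑ i ∈ Finset.range m, a i • b i) ≤ M) :
    CauchySeq fun m => ∑ i ∈ Finset.range m, a i • b i := by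
  rw [Metric.cauchySeq_iff']
  intro ε hε
  obtain ⟨j, hj⟩ : ∃ j : ℕ, C * (((2 : ℝ) ^ j)⁻¹ * (M + 1)) < ε / 3 := by
    have h1 : Tendsto (fun j : ℕ => C * ((1 / 2 : ℝ) ^ j * (M + 1))) atTop (𝓝 0) := by
      simpa using ((tendsto_pow_atTop_nhds_zero_of_lt_one (r := (1 / 2 : ℝ)) (by norm_num)
        (by norm_num)).mul_const (M + 1)).const_mul C
    obtain ⟨j, hj⟩ := (h1.eventually_lt_const (show 0 < ε / 3 by positivity)).exists
    exact ⟨j, by simpa using hj⟩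
  -- The error is uniform in `m` and below `ε / 3`; `M + 1` provides the strict bound.
  obtain ⟨s, hs, hsa⟩ := exists_cauchySeq_near hB hC0 hC (t := 2 ^ j) (by positivity)
    (M := M + 1) (fun m => (ha j m).trans_lt (lt_add_one M))
  obtain ⟨N, hN⟩ := Metric.cauchySeq_iff'.1 hs (ε / 3) (by positivity)
  refine ⟨N, fun n hn => ?_⟩
  have h1 := hN n hn
  have h2 := hsa n
  have h3 := hsa N
  rw [← dist_eq_norm] at h2 h3
  rw [dist_comm] at h3
  have := dist_triangle4 (∑ i ∈ Finset.range n, a i • b i) (s n) (s N)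
    (∑ i ∈ Finset.range N, a i • b i)
  linarith

end SchauderBasis

end Renorming

/-! ### Factorization through a reflexive space and noncompactness. -/

section Factorization

variable {𝕜 : Type v} [RCLike 𝕜]

/-- **Davis–Figiel–Johnson–Pełczyński interpolation**: a bounded weakly null Schauder basis is the
image of a bounded Schauder basis of a reflexive space. -/
theorem exists_reflexive_of_weaklyNull_basis {X : Type u} [NormedAddCommGroup X] [NormedSpace 𝕜 X]
    [CompleteSpace X] (b : SchauderBasis 𝕜 X) {B : ℝ} (hB : ∀ n, ‖b n‖ ≤ B)
    (hb : ∀ g : StrongDual 𝕜 X, Tendsto (fun n => g (b n)) atTop (𝓝 0)) :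
    ∃ (E : Type u) (_ : NormedAddCommGroup E) (_ : NormedSpace 𝕜 E) (_ : CompleteSpace E),
      IsReflexiveSpace 𝕜 E ∧ ∃ (e : SchauderBasis 𝕜 E) (T : E →L[𝕜] X) (R : ℝ),
        ∀ n, T (e n) = b n ∧ ‖e n‖ ≤ R := by
  obtain ⟨C₀, hC₀⟩ := b.exists_norm_proj_le
  let C := max C₀ 1
  have hC1 : 1 ≤ C := le_max_right _ _
  have hC0 : 0 ≤ C := zero_le_one.trans hC1
  have hC (m : ℕ) (x : X) : ‖b.proj m x‖ ≤ C * ‖x‖ :=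
    (b.proj m).le_of_opNorm_le ((hC₀ m).trans (le_max_left _ _)) x
  have hpow (j : ℕ) : (0 : ℝ) < 2 ^ j := by positivity
  choose G i1 i2 i3 ι hι using fun j : ℕ => exists_renorming (b.interpSeminorm (hpow j))
    (SchauderBasis.norm_le_interpSeminorm hB (hpow j))
    (SchauderBasis.interpSeminorm_le_norm (hpow j))
  have hgeom : HasSum (fun j : ℕ => (1 / 4 : ℝ) ^ j) (1 - 1 / 4)⁻¹ :=
    hasSum_geometric_of_lt_one (by norm_num) (by norm_num)
  have hbj (n j : ℕ) : ‖ι j (b n)‖ ^ 2 ≤ (1 / 4 : ℝ) ^ j := by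
    rw [hι]
    calc _ ≤ (((2 : ℝ) ^ j)⁻¹) ^ 2 := pow_le_pow_left₀ (apply_nonneg _ _)
          (SchauderBasis.interpSeminorm_basis_le (hpow j) n) 2
      _ = (1 / 4 : ℝ) ^ j := by
          rw [← inv_pow, ← pow_mul, mul_comm, pow_mul]
          norm_num
  have hproj (j m : ℕ) (x : X) : ‖ι j (b.proj m x)‖ ≤ C * ‖ι j x‖ := by
    rw [hι, hι]
    exact SchauderBasis.interpSeminorm_proj_le hC1 hC (hpow j) m x
  obtain ⟨e, he, heproj, hecoord⟩ := diagonalSpace.exists_basis b hproj fun n =>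
    Summable.of_nonneg_of_le (fun j => by positivity) (hbj n) hgeom.summable
  refine ⟨diagonalSpace ι, inferInstance, inferInstance, inferInstance, ?_, e,
    diagonalSpace.toX ι, √(1 - 1 / 4)⁻¹, fun n => ⟨he n, Real.le_sqrt_of_sq_le ?_⟩⟩
  · refine isReflexiveSpace_of_basis e (fun f ε hε =>
      diagonalSpace.exists_norm_sub_comp_proj_le b hC0 hproj (fun g ε hε => ?_) e heproj f hε)
      (diagonalSpace.exists_tendsto_of_bounded b (fun a M hM => ?_) e he hecoord)
    · simp only [hι]
      exact SchauderBasis.exists_norm_apply_sub_proj_le hC1 hC hb g hε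
    · simp only [hι] at hM
      exact SchauderBasis.cauchySeq_of_interpSeminorm_le hB hC0 hC hM
  · refine hasSum_le (fun j => ?_) (diagonalSpace.hasSum_norm_sq (e n)) hgeom
    rw [he]
    exact hbj n j

variable {F : Type u} [NormedAddCommGroup F] [NormedSpace 𝕜 F]

/-- Uniform boundedness on the dual, combined with the isometric embedding into the bidual. -/
theorem exists_norm_le_of_weaklyNull {y : ℕ → F}
    (hy : ∀ f : StrongDual 𝕜 F, Tendsto (fun n => f (y n)) atTop (𝓝 0)) :
    ∃ B, ∀ n, ‖y n‖ ≤ B := by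
  obtain ⟨B, hB⟩ := banach_steinhaus (g := fun n => NormedSpace.inclusionInDoubleDual 𝕜 F (y n))
    fun f => by
      obtain ⟨M, hM⟩ := isBounded_iff_forall_norm_le.1
        (Metric.isBounded_range_of_tendsto _ (hy f))
      exact ⟨M, fun n => hM _ ⟨n, rfl⟩⟩
  exact ⟨B, fun n => ((NormedSpace.inclusionInDoubleDualLi 𝕜).norm_map (y n)).symm.trans_le (hB n)⟩

theorem not_isCompactOperator_of_weaklyNull {E : Type u} [NormedAddCommGroup E] [NormedSpace 𝕜 E]
    (T : E →L[𝕜] F) {x : ℕ → E} {R δ : ℝ} (hx : ∀ n, ‖x n‖ ≤ R) (hδ : 0 < δ)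
    (hTx : ∀ n, δ ≤ ‖T (x n)‖)
    (hy : ∀ f : StrongDual 𝕜 F, Tendsto (fun n => f (T (x n))) atTop (𝓝 0)) :
    ¬ IsCompactOperator T := by
  intro hT
  obtain ⟨K, hK, hTK⟩ := IsCompactOperator.image_closedBall_subset_compact (𝕜₁ := 𝕜)
    (f := T.toLinearMap) hT R
  obtain ⟨a, -, φ, hφ, hlim⟩ := hK.tendsto_subseq (x := fun n => T (x n)) fun n =>
    hTK ⟨x n, by simpa using hx n, rfl⟩
  have ha : a = 0 := by
    refine SeparatingDual.eq_zero_of_forall_dual_eq_zero (R := 𝕜) fun f => ?_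
    exact tendsto_nhds_unique ((f.continuous.tendsto a).comp hlim)
      ((hy f).comp hφ.tendsto_atTop)
  have h1 : δ ≤ ‖a‖ := ge_of_tendsto' hlim.norm fun n => hTx (φ n)
  rw [ha, norm_zero] at h1
  exact hδ.not_ge h1

theorem exists_weaklyNull_of_not_hasSchurProperty (hF : ¬ HasSchurProperty 𝕜 F) :
    ∃ (y : ℕ → F) (δ : ℝ), 0 < δ ∧ (∀ n, δ ≤ ‖y n‖) ∧
      ∀ f : StrongDual 𝕜 F, Tendsto (fun n => f (y n)) atTop (𝓝 0) := by
  simp only [HasSchurProperty, not_forall] at hF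
  obtain ⟨x, a, hw, hn⟩ := hF
  rw [Metric.tendsto_atTop] at hn
  push Not at hn
  obtain ⟨δ, hδ, hfreq⟩ := hn
  obtain ⟨φ, hφ, hφδ⟩ := extraction_of_frequently_atTop
    (P := fun n => δ ≤ dist (x n) a) (frequently_atTop.2 hfreq)
  refine ⟨fun n => x (φ n) - a, δ, hδ, fun n => by simpa [dist_eq_norm] using hφδ n, fun f => ?_⟩
  have h1 : Tendsto (fun n => f (x n)) atTop (𝓝 (f a)) :=
    ((WeakBilin.eval_continuous (topDualPairing 𝕜 F).flip f).tendsto _).comp hw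
  simpa using (h1.comp hφ.tendsto_atTop).sub_const (f a)

end Factorization

theorem mainTheorem7 {𝕜 : Type v} [RCLike 𝕜] {F : Type u} [NormedAddCommGroup F]
    [NormedSpace 𝕜 F] [CompleteSpace F] (hF : ¬ HasSchurProperty 𝕜 F) :
    ∃ (E : Type u) (_ : NormedAddCommGroup E) (_ : NormedSpace 𝕜 E) (_ : CompleteSpace E),
      IsReflexiveSpace 𝕜 E ∧ Nonempty (SchauderBasis 𝕜 E) ∧
        compactOperator (RingHom.id 𝕜) E F ≠ ⊤ := by
  obtain ⟨y, δ, hδ, hyδ, hy⟩ := exists_weaklyNull_of_not_hasSchurProperty hF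
  obtain ⟨φ, hφ, hK⟩ := exists_basic_subseq hy hδ hyδ
  obtain ⟨X, hX, b, hb⟩ := exists_schauderBasis_of_basic hδ (fun n => hyδ (φ n)) hK
  obtain ⟨B, hB⟩ := exists_norm_le_of_weaklyNull hy
  obtain ⟨E, i1, i2, i3, hE, e, T, R, he⟩ := exists_reflexive_of_weaklyNull_basis b
    (fun n => by rw [Submodule.coe_norm, hb]; exact hB (φ n)) (fun g => by
      -- Weak nullity in `F` descends to `X` by Hahn–Banach extension of functionals.
      obtain ⟨f, hf, -⟩ := exists_extension_norm_eq X g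
      refine ((hy f).comp hφ.tendsto_atTop).congr fun n => ?_
      rw [← hf, hb]
      rfl)
  refine ⟨E, i1, i2, i3, hE, ⟨e⟩, fun htop => ?_⟩
  have hT (n : ℕ) : (X.subtypeL ∘L T) (e n) = y (φ n) := by
    rw [← hb n, ← (he n).1]
    rfl
  refine not_isCompactOperator_of_weaklyNull (X.subtypeL ∘L T) (fun n => (he n).2) hδ
    (fun n => by rw [hT]; exact hyδ _) (fun f => ?_) ?_
  · simp only [hT]
    exact (hy f).comp hφ.tendsto_atTop
  · have : X.subtypeL ∘L T ∈ compactOperator (RingHom.id 𝕜) E F := htop ▸ Submodule.mem_top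
    exact this
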